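/- A Euclidean Jordan algebra (EJA) is a real Hilbert space $E$, of finite or infinite dimension, with a bilinear, commutative, not necessarily associative product $*$ that has a unit $1$ and satisfies the Jordan identity $(a*b)*(a*a)=a*(b*(a*a))$ and $\langle a*b,c\rangle=\langle b,a*c\rangle$ for all $a,b,c\in E$. An element $a\in E$ is positive, written $a\geq 0$, if $a=b*b$ for some $b\in E$; write $a\leq c$ if $c-a\geq 0$. An effect is an element $a\in E$ with $0\leq a\leq 1$. A linear map $f\colon E\to F$ between EJAs is positive if $f(a)\geq 0$ whenever $a\geq 0$. An image of $f$ is a smallest effect $q\in E$ with $f(q)=f(1)$, that is, an effect $q$ with $f(q)=f(1)$ such that $q\leq r$ for every effect $r\in E$ with $f(r)=f(1)$. Proposition. Every positive linear map $f\colon E\to F$ between EJAs has a unique image, and this image $q$ is an idempotent, i.e. $q*q=q$. -/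

import Mathlib

/-- A Euclidean Jordan algebra, of arbitrary dimension: a real Hilbert space with a commutative
bilinear product that has a unit, satisfies the Jordan identity
`(a * b) * (a * a) = a * (b * (a * a))` (this is `IsCommJordan`), and for which multiplication by
any element is symmetric with respect to the inner product. The product is not assumed to be
associative, nor to be continuous or submultiplicative for the norm. -/
class EuclideanJordanAlgebra (E : Type*) extends NormedAddCommGroup E, InnerProductSpace ℝ E,
    CompleteSpace E, MulOneClass E, CommMagma E, IsCommJordan E where
  add_mul' : ∀ a b c : E, (a + b) * c = a * c + b * c
  smul_mul' : ∀ (t : ℝ) (a b : E), (t • a) * b = t • (a * b)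
  inner_mul' : ∀ a b c : E, Inner.inner ℝ (a * b) c = Inner.inner ℝ b (a * c)

namespace EuclideanJordanAlgebra

/-- An element is positive when it is a square. -/
def IsPos {E : Type*} [EuclideanJordanAlgebra E] (a : E) : Prop :=
  ∃ b : E, a = b * b

/-- The order of a Euclidean Jordan algebra: `a ≤ c` when `c - a` is positive. -/
def Le {E : Type*} [EuclideanJordanAlgebra E] (a c : E) : Prop :=
  IsPos (c - a)

/-- An effect is an element `a` with `0 ≤ a ≤ 1`. -/
def IsEffect {E : Type*} [EuclideanJordanAlgebra E] (a : E) : Prop :=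
  Le 0 a ∧ Le a 1

/-- A linear map is positive when it maps positive elements to positive elements. -/
def IsPosMap {E F : Type*} [EuclideanJordanAlgebra E] [EuclideanJordanAlgebra F]
    (f : E →ₗ[ℝ] F) : Prop :=
  ∀ a : E, IsPos a → IsPos (f a)

/-- `q` is an image of `f`: it is a smallest effect with `f q = f 1`. -/
def IsImage {E F : Type*} [EuclideanJordanAlgebra E] [EuclideanJordanAlgebra F]
    (f : E →ₗ[ℝ] F) (q : E) : Prop :=
  (IsEffect q ∧ f q = f 1) ∧ ∀ r : E, IsEffect r → f r = f 1 → Le q r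

end EuclideanJordanAlgebra

/-! The effects `r` with `f r = f 1` are the complements of the effects killed by `f`, so the image
is `1 - p` for `p` the largest effect in the kernel. Even in infinite dimension the product is
automatically bounded, so nonzero idempotents have norms bounded below
(`exists_idempotent_norm_bound`). Splitting idempotents off `1` therefore stops, and every element
is a finite combination of orthogonal idempotents (`exists_spectral`). The same gap makes a kernel
idempotent `p` of nearly maximal norm actually maximal: for positive `r` in the kernel, the spectral
idempotents of `p + r` are killed by `f`, and their sum dominates `p`, hence equals `p`
(`IsPosMap.exists_max_idempotent`). Thus `r` is supported under `p`, and an effect so supported lies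
below `p` (`le_of_inner_eq_zero`). Uniqueness is antisymmetry, from faithfulness of the trace `⟨·,
1⟩`. -/

namespace EuclideanJordanAlgebra

open Filter Topology

/-! ### Jordan identities, idempotents and the trace -/

section Algebra

variable {E : Type*} [EuclideanJordanAlgebra E]

scoped instance : NonUnitalNonAssocCommRing E where
  left_distrib a b c := by
    rw [mul_comm a, add_mul', mul_comm b, mul_comm c]
  right_distrib := add_mul'
  zero_mul a := by simpa using smul_mul' (0 : ℝ) (0 : E) a
  mul_zero a := by rw [mul_comm]; simpa using smul_mul' (0 : ℝ) (0 : E) a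
  mul_comm := mul_comm

scoped instance : IsScalarTower ℝ E E := ⟨fun t a b => smul_mul' t a b⟩

scoped instance : SMulCommClass ℝ E E :=
  ⟨fun t a b => by
    simp only [smul_eq_mul]
    rw [mul_comm a (t • b), smul_mul', mul_comm b]⟩

theorem inner_mul (a b c : E) : inner ℝ (a * b) c = inner ℝ b (a * c) := inner_mul' a b c

theorem inner_mul_right_comm (a b c : E) : inner ℝ (a * b) c = inner ℝ a (b * c) := by
  rw [mul_comm, inner_mul]

/-- First linearisation of the Jordan identity. -/
theorem jordan_linearized (a b c : E) :
    (c * b) * (a * a) + (2 : ℝ) • ((a * b) * (a * c)) =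
      c * (b * (a * a)) + (2 : ℝ) • (a * (b * (a * c))) := by
  have h1 := IsCommJordan.lmul_comm_rmul_rmul (a + c) b
  have h2 := IsCommJordan.lmul_comm_rmul_rmul (a - c) b
  have h3 := IsCommJordan.lmul_comm_rmul_rmul c b
  simp only [add_mul, mul_add, sub_mul, mul_sub, mul_comm c a] at h1 h2 h3 ⊢
  linear_combination (norm := module) (1 / 2 : ℝ) • h1 - (1 / 2 : ℝ) • h2 - h3

/-- Full linearisation of the Jordan identity. -/
theorem jordan_full (a b c d : E) :
    (c * b) * (a * d) + (d * b) * (a * c) + (a * b) * (d * c) =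
      c * (b * (a * d)) + d * (b * (a * c)) + a * (b * (d * c)) := by
  have h1 := jordan_linearized (a + d) b c
  have h2 := jordan_linearized a b c
  have h3 := jordan_linearized d b c
  simp only [add_mul, mul_add, mul_comm d a] at h1 h2 h3 ⊢
  linear_combination (norm := module) (1 / 2 : ℝ) • h1 - (1 / 2 : ℝ) • h2 - (1 / 2 : ℝ) • h3

/-- Multiplication by `p` is a root of `2X³ - 3X² + X`, so its only possible eigenvalues are 0, 1/2
and 1. -/
theorem peirce_cubic {p : E} (hp : p * p = p) (c : E) :
    (3 : ℝ) • (p * (p * c)) = p * c + (2 : ℝ) • (p * (p * (p * c))) := by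
  have h := jordan_linearized p p c
  simp only [hp, mul_comm c p, mul_comm (p * c) p] at h
  linear_combination (norm := module) h

/-- Multiplication by an idempotent is a positive operator. -/
theorem inner_mul_self_eq {p : E} (hp : p * p = p) (x : E) :
    inner ℝ x (p * x) = ‖p * x‖ ^ 2 + 4 * ‖p * x - p * (p * x)‖ ^ 2 := by
  have h := peirce_cubic hp x
  have h' := congrArg (fun z => inner ℝ x z) h
  have h'' := congrArg (fun z => inner ℝ (p * x) z) h
  simp only [inner_add_right, inner_smul_right, inner_mul] at h' h''
  rw [← real_inner_self_eq_norm_sq, ← real_inner_self_eq_norm_sq]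
  simp only [inner_sub_left, inner_sub_right, inner_mul]
  linarith

theorem inner_mul_self_nonneg {p : E} (hp : p * p = p) (x : E) : 0 ≤ inner ℝ x (p * x) := by
  rw [inner_mul_self_eq hp]; positivity

theorem mul_eq_zero_of_inner {p : E} (hp : p * p = p) {x : E} (h : inner ℝ x (p * x) = 0) :
    p * x = 0 := by
  rw [inner_mul_self_eq hp] at h
  have : ‖p * x‖ ^ 2 = 0 := by nlinarith [sq_nonneg ‖p * x‖, sq_nonneg ‖p * x - p * (p * x)‖]
  simpa using this

theorem IsPos.inner_nonneg {a p : E} (ha : IsPos a) (hp : p * p = p) : 0 ≤ inner ℝ a p := by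
  obtain ⟨b, rfl⟩ := ha
  rw [inner_mul, mul_comm]
  exact inner_mul_self_nonneg hp b

theorem mul_eq_zero_of_idempotents {p q : E} (hp : p * p = p) (hq : q * q = q)
    (h : inner ℝ p q = 0) : q * p = 0 := by
  apply mul_eq_zero_of_inner hq
  rw [mul_comm, ← inner_mul, hp, h]

theorem isPos_of_idempotent {p : E} (hp : p * p = p) : IsPos p := ⟨p, hp.symm⟩

theorem IsPos.inner_one_nonneg {a : E} (ha : IsPos a) : 0 ≤ inner ℝ a 1 :=
  ha.inner_nonneg (mul_one 1)

theorem IsPos.eq_zero_of_inner_one {a : E} (ha : IsPos a) (h : inner ℝ a 1 = 0) : a = 0 := by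
  obtain ⟨b, rfl⟩ := ha
  rw [inner_mul, mul_one, inner_self_eq_zero] at h
  simp [h]

theorem Le.antisymm {a b : E} (h : Le a b) (h' : Le b a) : a = b := by
  have h1 := IsPos.inner_one_nonneg h'
  have h2 := IsPos.inner_one_nonneg h
  rw [← neg_sub, inner_neg_left] at h1
  exact (sub_eq_zero.1 (IsPos.eq_zero_of_inner_one h (by linarith))).symm

theorem idempotent_sub {p q : E} (hp : p * p = p) (hq : q * q = q) (h : q * p = q) :
    (p - q) * (p - q) = p - q := by
  simp [sub_mul, mul_sub, hp, hq, h, mul_comm p q]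

theorem idempotent_one_sub {p : E} (hp : p * p = p) : (1 - p) * (1 - p) = 1 - p :=
  idempotent_sub (mul_one 1) hp (mul_one p)

theorem isEffect_one_sub {a : E} (ha : IsEffect a) : IsEffect (1 - a) := by
  obtain ⟨h0, h1⟩ := ha
  constructor
  · simpa [Le] using h1
  · simpa [Le] using h0

theorem isEffect_of_idempotent {p : E} (hp : p * p = p) : IsEffect p := by
  constructor
  · simpa [Le] using isPos_of_idempotent hp
  · exact isPos_of_idempotent (idempotent_one_sub hp)

theorem norm_sq_of_idempotent {p : E} (hp : p * p = p) : ‖p‖ ^ 2 = inner ℝ p 1 := by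
  conv_rhs => rw [← hp, inner_mul, mul_one]
  rw [real_inner_self_eq_norm_sq]

theorem norm_sq_idempotent_sub {p q : E} (hp : p * p = p) (hq : q * q = q) (h : q * p = q) :
    ‖p - q‖ ^ 2 = ‖p‖ ^ 2 - ‖q‖ ^ 2 := by
  rw [norm_sq_of_idempotent (idempotent_sub hp hq h), norm_sq_of_idempotent hp,
    norm_sq_of_idempotent hq, inner_sub_left]

theorem norm_sq_le_of_idempotent {p : E} (hp : p * p = p) : ‖p‖ ^ 2 ≤ ‖(1 : E)‖ ^ 2 := by
  have := norm_sq_idempotent_sub (mul_one 1) hp (mul_one p)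
  nlinarith [sq_nonneg ‖1 - p‖]

end Algebra

/-! ### Power-associativity -/

section Powers

variable {E : Type*} [EuclideanJordanAlgebra E]

/-- Powers in a Jordan algebra, defined by repeated left multiplication. -/
def jpow (a : E) : ℕ → E
  | 0 => 1
  | n + 1 => a * jpow a n

@[simp] theorem jpow_zero (a : E) : jpow a 0 = 1 := rfl

theorem jpow_succ (a : E) (n : ℕ) : jpow a (n + 1) = a * jpow a n := rfl

@[simp] theorem jpow_one (a : E) : jpow a 1 = a := mul_one a

theorem jpow_smul (t : ℝ) (a : E) (n : ℕ) : jpow (t • a) n = t ^ n • jpow a n := by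
  induction n with
  | zero => simp
  | succ n ih => rw [jpow_succ, ih, smul_mul_smul_comm, jpow_succ, pow_succ']

/-- Multiplication by a power becomes a polynomial in multiplications by `a`, `a * a` and lower
powers, so commutation passes up by induction. -/
theorem mul_jpow_add_two (a d : E) (n : ℕ) :
    jpow a (n + 2) * d =
      (2 : ℝ) • (jpow a (n + 1) * (a * d)) + (a * a) * (jpow a n * d)
        - jpow a n * (a * (a * d)) - a * (a * (jpow a n * d)) := by
  have h := jordan_full a a (jpow a n) d
  simp only [jpow_succ, mul_comm (jpow a n) a, mul_comm d a, mul_comm d (jpow a n),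
    mul_comm (a * d) (a * jpow a n), mul_comm d (a * (a * jpow a n))] at h ⊢
  linear_combination (norm := module) -h

/-- A linear operator that commutes with multiplication by `a` and by `a * a` commutes with
multiplication by every power of `a`. -/
theorem commute_jpow (a : E) (X : E →ₗ[ℝ] E) (h1 : ∀ d, X (a * d) = a * X d)
    (h2 : ∀ d, X ((a * a) * d) = (a * a) * X d) (n : ℕ) :
    ∀ d, X (jpow a n * d) = jpow a n * X d := by
  induction n using Nat.twoStepInduction with
  | zero => simp
  | one => simpa using h1
  | more n ih ih' =>
    intro d
    rw [mul_jpow_add_two, mul_jpow_add_two]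
    simp only [map_add, map_sub, map_smul, h1, h2, ih, ih']

/-- Multiplication by a fixed element, as a linear map. -/
abbrev lmul (a : E) : E →ₗ[ℝ] E := LinearMap.mulLeft ℝ a

theorem mul_mul_sq_comm (a d : E) : a * ((a * a) * d) = (a * a) * (a * d) := by
  have := IsCommJordan.lmul_comm_rmul_rmul a d
  rw [mul_comm (a * a) d, ← this, mul_comm]

theorem jpow_commute (a : E) (m n : ℕ) (d : E) :
    jpow a m * (jpow a n * d) = jpow a n * (jpow a m * d) := by
  have h1 : ∀ k d, a * (jpow a k * d) = jpow a k * (a * d) := fun k =>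
    commute_jpow a (lmul a) (fun _ => rfl) (fun d => mul_mul_sq_comm a d) k
  have h2 : ∀ k d, (a * a) * (jpow a k * d) = jpow a k * ((a * a) * d) := fun k =>
    commute_jpow a (lmul (a * a)) (fun d => (mul_mul_sq_comm a d).symm) (fun _ => rfl) k
  exact commute_jpow a (lmul (jpow a m)) (fun d => (h1 m d).symm) (fun d => (h2 m d).symm) n d

theorem jpow_add (a : E) (m n : ℕ) : jpow a (m + n) = jpow a m * jpow a n := by
  induction m with
  | zero => simp
  | succ m ih =>
    have := jpow_commute a 1 n (jpow a m)
    rw [show m + 1 + n = m + n + 1 by ring, jpow_succ, ih, jpow_succ,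
      mul_comm (a * jpow a m)]
    simpa [mul_comm (jpow a n) (jpow a m)] using this

theorem inner_jpow (a : E) (m n : ℕ) : inner ℝ (jpow a m) (jpow a n) = inner ℝ (jpow a (m + n)) 1 := by
  rw [add_comm, jpow_add, inner_mul, mul_one]

theorem norm_jpow_sq (a : E) (n : ℕ) : ‖jpow a n‖ ^ 2 = inner ℝ (jpow a (2 * n)) 1 := by
  rw [← real_inner_self_eq_norm_sq, inner_jpow, two_mul]

end Powers

/-! ### Automatic continuity and associative subalgebras -/

section Continuity

variable {E : Type*} [EuclideanJordanAlgebra E]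

/-- Hellinger–Toeplitz: an everywhere defined symmetric operator is bounded. -/
theorem continuous_mul_left_fixed (a : E) : Continuous fun b : E => a * b :=
  LinearMap.IsSymmetric.continuous (T := lmul a) fun b c => inner_mul a b c

theorem exists_norm_mul_le (E : Type*) [EuclideanJordanAlgebra E] :
    ∃ K : ℝ, 0 < K ∧ ∀ a b : E, ‖a * b‖ ≤ K * ‖a‖ * ‖b‖ := by
  let g : {a : E // ‖a‖ ≤ 1} → E →L[ℝ] E := fun a => ⟨lmul a.1, continuous_mul_left_fixed a.1⟩
  obtain ⟨C, hC⟩ := banach_steinhaus (g := g) fun b => by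
    -- By commutativity, multiplication by `b` bounds the whole family at the point `b`.
    let h : E →L[ℝ] E := ⟨lmul b, continuous_mul_left_fixed b⟩
    refine ⟨‖h‖, fun a => ?_⟩
    change ‖a.1 * b‖ ≤ ‖h‖
    rw [mul_comm]
    exact (h.le_opNorm a.1).trans (mul_le_of_le_one_right (norm_nonneg _) a.2)
  have hC0 : 0 ≤ C := (norm_nonneg _).trans (hC ⟨0, by simp⟩)
  refine ⟨C + 1, by linarith, fun a b => ?_⟩
  have key : ‖a * b‖ ≤ C * ‖a‖ * ‖b‖ := by
    rcases eq_or_ne a 0 with rfl | ha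
    · simp
    have ha' : 0 < ‖a‖ := norm_pos_iff.2 ha
    have h1 : ‖(‖a‖⁻¹ • a)‖ ≤ 1 := by
      rw [norm_smul, norm_inv, norm_norm, inv_mul_cancel₀ ha'.ne']
    have h2 : ‖(‖a‖⁻¹ • a) * b‖ ≤ C * ‖b‖ :=
      ((g ⟨_, h1⟩).le_opNorm b).trans (mul_le_mul_of_nonneg_right (hC _) (norm_nonneg _))
    rw [smul_mul_assoc, norm_smul, norm_inv, norm_norm, inv_mul_le_iff₀ ha'] at h2
    linarith
  nlinarith [mul_nonneg (norm_nonneg a) (norm_nonneg b)]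

scoped instance : ContinuousMul E where
  continuous_mul := by
    obtain ⟨K, -, hK⟩ := exists_norm_mul_le E
    exact (LinearMap.mkContinuous₂ (LinearMap.mul ℝ E) K hK).continuous₂

/-- A closed unital subalgebra on which the product is associative. -/
structure IsAssocClosed (A : Submodule ℝ E) : Prop where
  closed : IsClosed (A : Set E)
  one_mem : (1 : E) ∈ A
  mul_mem : ∀ x ∈ A, ∀ y ∈ A, x * y ∈ A
  assoc : ∀ x ∈ A, ∀ y ∈ A, ∀ z ∈ A, (x * y) * z = x * (y * z)

/-- Take the closed span of the powers of `a`. Their multiplications commute, also in the limit, and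
for a commutative product this gives associativity. -/
theorem exists_isAssocClosed (a : E) : ∃ A : Submodule ℝ E, IsAssocClosed A ∧ a ∈ A := by
  let W := Submodule.span ℝ (Set.range (jpow a))
  have hW : ∀ n, jpow a n ∈ W := fun n => Submodule.subset_span ⟨n, rfl⟩
  have hmul : ∀ x ∈ W, ∀ y ∈ W, x * y ∈ W := fun x hx y hy => by
    induction hx, hy using Submodule.span_induction₂ with
    | mem_mem x y hx hy =>
      obtain ⟨m, rfl⟩ := hx
      obtain ⟨n, rfl⟩ := hy
      rw [← jpow_add]
      exact hW _
    | zero_left y hy => simp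
    | zero_right x hx => simp
    | add_left x y z _ _ _ h1 h2 => rw [add_mul]; exact add_mem h1 h2
    | add_right x y z _ _ _ h1 h2 => rw [mul_add]; exact add_mem h1 h2
    | smul_left r x y _ _ h => rw [smul_mul_assoc]; exact W.smul_mem _ h
    | smul_right r x y _ _ h => rw [mul_smul_comm]; exact W.smul_mem _ h
  have hcomm : ∀ x ∈ W, ∀ y ∈ W, ∀ d : E, x * (y * d) = y * (x * d) := fun x hx y hy => by
    induction hx, hy using Submodule.span_induction₂ with
    | mem_mem x y hx hy =>
      obtain ⟨m, rfl⟩ := hx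
      obtain ⟨n, rfl⟩ := hy
      exact jpow_commute a m n
    | zero_left y hy => simp
    | zero_right x hx => simp
    | add_left x y z _ _ _ h1 h2 => intro d; simp only [add_mul, mul_add, h1, h2]
    | add_right x y z _ _ _ h1 h2 => intro d; simp only [add_mul, mul_add, h1, h2]
    | smul_left r x y _ _ h => intro d; simp only [smul_mul_assoc, mul_smul_comm, h]
    | smul_right r x y _ _ h => intro d; simp only [smul_mul_assoc, mul_smul_comm, h]
  have hcl : ∀ x ∈ closure (W : Set E), ∀ y ∈ closure (W : Set E), ∀ d : E,
      x * (y * d) = y * (x * d) := fun x hx y hy d => by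
    have hc : IsClosed {q : E × E | q.1 * (q.2 * d) = q.2 * (q.1 * d)} :=
      isClosed_eq (by fun_prop) (by fun_prop)
    have hsub : (W : Set E) ×ˢ (W : Set E) ⊆ {q : E × E | q.1 * (q.2 * d) = q.2 * (q.1 * d)} :=
      fun q hq => hcomm q.1 hq.1 q.2 hq.2 d
    have := closure_minimal hsub hc
    rw [closure_prod_eq] at this
    exact this (Set.mk_mem_prod hx hy)
  refine ⟨W.topologicalClosure, ⟨W.isClosed_topologicalClosure, ?_, ?_, ?_⟩, ?_⟩
  · exact W.le_topologicalClosure (hW 0)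
  · exact fun x hx y hy => map_mem_closure₂ continuous_mul hx hy hmul
  · intro x hx y hy z hz
    rw [mul_comm (x * y), hcl z hz x hx, mul_comm z y]
  · exact W.le_topologicalClosure (by simpa using hW 1)

end Continuity

/-! ### Spectral theorem and the positive cone -/

section Spectral

variable {E : Type*} [EuclideanJordanAlgebra E]

theorem jpow_ne_zero {x : E} (hx : x ≠ 0) (n : ℕ) : jpow x n ≠ 0 := by
  induction n using Nat.twoStepInduction with
  | zero =>
    intro h
    rw [jpow_zero] at h
    exact hx (by rw [← mul_one x, h, mul_zero])
  | one => simpa using hx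
  | more n _ ih =>
    intro h
    apply ih
    rw [← inner_self_eq_zero (𝕜 := ℝ), inner_jpow, show n + 1 + (n + 1) = n + (n + 2) by ring,
      ← inner_jpow, h, inner_zero_right]

/-- A nonzero element can be rescaled so that the norms of its powers decrease to a positive
limit. -/
theorem exists_scale {x : E} (hx : x ≠ 0) :
    ∃ t : ℝ, 0 < t ∧ Antitone (fun n => ‖jpow (t • x) n‖) ∧
      ∃ δ : ℝ, 0 < δ ∧ ∀ n, δ ≤ ‖jpow (t • x) n‖ := by
  obtain ⟨K, hK0, hK⟩ := exists_norm_mul_le E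
  set u : ℕ → ℝ := fun n => ‖jpow x n‖ with hu
  have hpos : ∀ n, 0 < u n := fun n => norm_pos_iff.2 (jpow_ne_zero hx n)
  set ρ : ℕ → ℝ := fun n => u (n + 1) / u n with hρ
  have hρpos : ∀ n, 0 < ρ n := fun n => div_pos (hpos _) (hpos _)
  -- Cauchy–Schwarz: the norms of the powers are log-convex, so their ratios increase.
  have hlog : ∀ n, u (n + 1) * u (n + 1) ≤ u n * u (n + 2) := fun n => by
    have h := real_inner_le_norm (jpow x n) (jpow x (n + 2))
    rw [inner_jpow, show n + (n + 2) = 2 * (n + 1) by ring, ← norm_jpow_sq, sq] at h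
    exact h
  have hmono : Monotone ρ := monotone_nat_of_le_succ fun n => by
    simp only [hρ]
    rw [div_le_div_iff₀ (hpos _) (hpos _)]
    linarith [hlog n]
  have hle : ∀ n, ρ n ≤ K * u 1 := fun n => by
    simp only [hρ]
    rw [div_le_iff₀ (hpos _)]
    simpa [hu, jpow_succ] using hK x (jpow x n)
  have hbdd : BddAbove (Set.range ρ) := ⟨K * u 1, by rintro _ ⟨n, rfl⟩; exact hle n⟩
  have hgrow : ∀ m n, ρ m ^ n * u m ≤ u (m + n) := fun m n => by
    induction n with
    | zero => simp
    | succ n ih =>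
      have h1 : ρ m ≤ ρ (m + n) := hmono (by omega)
      have h2 : ρ (m + n) * u (m + n) = u (m + n + 1) := div_mul_cancel₀ _ (hpos _).ne'
      calc ρ m ^ (n + 1) * u m = ρ m * (ρ m ^ n * u m) := by ring
        _ ≤ ρ m * u (m + n) := mul_le_mul_of_nonneg_left ih (hρpos m).le
        _ ≤ ρ (m + n) * u (m + n) := mul_le_mul_of_nonneg_right h1 (hpos _).le
        _ = u (m + (n + 1)) := h2
  have hlow : ∀ m n, ρ m ^ n ≤ K * u n := fun m n => by
    have h1 := hgrow m n
    have h2 : u (m + n) ≤ K * u m * u n := by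
      simp only [hu]
      rw [jpow_add]
      exact hK _ _
    refine le_of_mul_le_mul_right ?_ (hpos m)
    linarith
  set r : ℝ := ⨆ n, ρ n with hr
  have hrle : ∀ n, ρ n ≤ r := fun n => le_ciSup hbdd n
  have hr0 : 0 < r := (hρpos 0).trans_le (hrle 0)
  have htend : Tendsto ρ atTop (𝓝 r) := tendsto_atTop_ciSup hmono hbdd
  have hlow' : ∀ n, r ^ n ≤ K * u n := fun n =>
    le_of_tendsto' (htend.pow n) fun m => hlow m n
  have hnorm : ∀ n, ‖jpow (r⁻¹ • x) n‖ = u n / r ^ n := fun n => by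
    rw [jpow_smul, norm_smul, norm_pow, norm_inv, Real.norm_of_nonneg hr0.le, inv_pow,
      inv_mul_eq_div]
  refine ⟨r⁻¹, inv_pos.2 hr0, ?_, K⁻¹, inv_pos.2 hK0, fun n => ?_⟩
  · refine antitone_nat_of_succ_le fun n => ?_
    rw [hnorm, hnorm, pow_succ, div_le_div_iff₀ (by positivity) (by positivity)]
    have h1 : u (n + 1) ≤ r * u n := (div_le_iff₀ (hpos n)).1 (hrle n)
    have h2 : 0 < r ^ n := by positivity
    nlinarith
  · rw [hnorm, le_div_iff₀ (by positivity), inv_mul_le_iff₀ hK0]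
    exact hlow' n

/-- The even powers of a suitable multiple of a nonzero element converge to a nonzero
idempotent. -/
theorem exists_idempotent_limit {x : E} (hx : x ≠ 0) :
    ∃ (t : ℝ) (e : E), 0 < t ∧ e ≠ 0 ∧ e * e = e ∧
      Tendsto (fun n => jpow (t • x) (2 * n)) atTop (𝓝 e) := by
  obtain ⟨t, ht, hanti, δ, hδ, hlow⟩ := exists_scale hx
  set y := t • x with hy
  set v : ℕ → ℝ := fun n => ‖jpow y n‖ ^ 2 with hv
  have hvanti : Antitone v := fun m n h => pow_le_pow_left₀ (norm_nonneg _) (hanti h) 2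
  obtain ⟨l, hl⟩ : ∃ l, Tendsto v atTop (𝓝 l) :=
    ⟨_, tendsto_atTop_ciInf hvanti ⟨0, by rintro _ ⟨n, rfl⟩; exact sq_nonneg _⟩⟩
  -- The inner product of two powers depends only on the sum of the exponents; even exponents turn
  -- it into a value of `v`.
  have hdist : ∀ m n, ‖jpow y (2 * m) - jpow y (2 * n)‖ ^ 2 =
      v (2 * m) - 2 * v (m + n) + v (2 * n) := fun m n => by
    rw [norm_sub_sq_real, inner_jpow, ← mul_add, ← norm_jpow_sq]
  have hcauchy : CauchySeq fun n => jpow y (2 * n) := by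
    rw [Metric.cauchySeq_iff']
    intro ε hε
    obtain ⟨N, hN⟩ := (Metric.tendsto_atTop.1 hl) (ε ^ 2 / 4) (by positivity)
    refine ⟨N, fun n hn => ?_⟩
    have h1 := abs_lt.1 (hN (2 * n) (by omega))
    have h2 := abs_lt.1 (hN (n + N) (by omega))
    have h3 := abs_lt.1 (hN (2 * N) (by omega))
    rw [dist_eq_norm]
    refine lt_of_pow_lt_pow_left₀ 2 hε.le ?_
    rw [hdist]
    linarith [h1.2, h2.1, h3.2]
  obtain ⟨e, he⟩ := cauchySeq_tendsto_of_complete hcauchy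
  refine ⟨t, e, ht, ?_, ?_, he⟩
  · rintro rfl
    have := ge_of_tendsto' he.norm fun n => hlow (2 * n)
    simp at this
    linarith
  -- Squaring the sequence gives a subsequence of it.
  · refine tendsto_nhds_unique (he.mul he) ?_
    have h2 : Tendsto (fun n : ℕ => 2 * n) atTop atTop :=
      tendsto_id.const_mul_atTop' (by norm_num)
    refine (he.comp h2).congr fun n => ?_
    simp only [Function.comp]
    rw [← jpow_add]
    congr 1
    ring

theorem IsAssocClosed.jpow_mem {A : Submodule ℝ E} (hA : IsAssocClosed A) {x : E} (hx : x ∈ A)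
    (n : ℕ) : jpow x n ∈ A := by
  induction n with
  | zero => exact hA.one_mem
  | succ n ih => exact hA.mul_mem _ hx _ ih

theorem half_idempotent {e y : E} (he : e * e = e) (hey : e * y = y) (hy : y * y = e) :
    ((1 / 2 : ℝ) • (e + y)) * ((1 / 2 : ℝ) • (e + y)) = (1 / 2 : ℝ) • (e + y) := by
  simp only [smul_mul_smul_comm, add_mul, mul_add, he, hey, hy, mul_comm y e]
  module

/-- A nonzero element of an associative closed subalgebra, supported by the idempotent `u`, has an
eigen-idempotent below `u` for a nonzero eigenvalue. -/
theorem IsAssocClosed.exists_eigen {A : Submodule ℝ E} (hA : IsAssocClosed A) {x u : E}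
    (hx : x ∈ A) (hu : u ∈ A) (hxu : x * u = x) (hx0 : x ≠ 0) :
    ∃ (μ : ℝ) (p : E), p ∈ A ∧ p ≠ 0 ∧ p * p = p ∧ p * u = p ∧ x * p = μ • p := by
  obtain ⟨t, e, ht, he0, he, hlim⟩ := exists_idempotent_limit hx0
  set y := t • x with hy
  have hyA : y ∈ A := A.smul_mem t hx
  have heA : e ∈ A := hA.closed.mem_of_tendsto hlim (Eventually.of_forall fun n => hA.jpow_mem hyA _)
  have hlim' : Tendsto (fun n => jpow y (2 * (n + 1))) atTop (𝓝 e) :=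
    hlim.comp (tendsto_add_atTop_nat 1)
  have hyu : y * u = y := by rw [hy, smul_mul_assoc, hxu]
  have heu : e * u = e := by
    refine tendsto_nhds_unique (hlim'.mul_const u) (hlim'.congr fun n => ?_)
    rw [show 2 * (n + 1) = 2 * n + 1 + 1 by ring, jpow_succ, mul_comm y,
      hA.assoc _ (hA.jpow_mem hyA _) _ hyA _ hu, hyu]
  have hyye : y * (y * e) = e := by
    refine tendsto_nhds_unique ((hlim.const_mul y).const_mul y) (hlim'.congr fun n => ?_)
    rw [show 2 * (n + 1) = 2 * n + 1 + 1 by ring, jpow_succ, jpow_succ]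
  set z := y * e with hz
  have hzA : z ∈ A := hA.mul_mem _ hyA _ heA
  have hez : e * z = z := by
    rw [hz, mul_comm, hA.assoc _ hyA _ heA _ heA, he]
  have hzz : z * z = e := by
    conv_lhs => rw [hz, hA.assoc _ hyA _ heA _ hzA, hez, hyye]
  have hzu : z * u = z := by rw [hz, hA.assoc _ hyA _ heA _ hu, heu]
  have hxy : ∀ w, x * w = t⁻¹ • (y * w) := fun w => by
    rw [hy, smul_mul_assoc, smul_smul, inv_mul_cancel₀ ht.ne', one_smul]
  -- Even powers lose the sign of the eigenvalue: `z` is a square root of `e`, so either `z = -e`,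
  -- or `(e + z) / 2` is a nonzero idempotent fixed by `y`.
  by_cases h : e + z = 0
  · refine ⟨-t⁻¹, e, heA, he0, he, heu, ?_⟩
    rw [hxy, ← hz, eq_neg_of_add_eq_zero_right h]
    simp
  · refine ⟨t⁻¹, (1 / 2 : ℝ) • (e + z), A.smul_mem _ (A.add_mem heA hzA),
      smul_ne_zero (by norm_num) h, half_idempotent he hez hzz, ?_, ?_⟩
    · rw [smul_mul_assoc, add_mul, heu, hzu]
    · rw [hxy, mul_smul_comm, mul_add, ← hz, hyye, add_comm z e]

/-- From `‖p‖ = ‖p * p‖ ≤ K‖p‖²`. -/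
theorem exists_idempotent_norm_bound (E : Type*) [EuclideanJordanAlgebra E] :
    ∃ c : ℝ, 0 < c ∧ ∀ p : E, p * p = p → p ≠ 0 → c ≤ ‖p‖ ^ 2 := by
  obtain ⟨K, hK0, hK⟩ := exists_norm_mul_le E
  refine ⟨K⁻¹ ^ 2, by positivity, fun p hp hp0 => ?_⟩
  have hpos : 0 < ‖p‖ := norm_pos_iff.2 hp0
  have h := hK p p
  rw [hp] at h
  refine pow_le_pow_left₀ (by positivity) ?_ 2
  rw [inv_le_iff_one_le_mul₀' hK0]
  exact le_of_mul_le_mul_right (by linarith) hpos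

/-- A finite set of nonzero, mutually orthogonal idempotents. -/
structure IsOrthogonalSystem (s : Finset E) : Prop where
  idem : ∀ e ∈ s, e * e = e
  ne_zero : ∀ e ∈ s, e ≠ 0
  orth : ∀ e ∈ s, ∀ e' ∈ s, e ≠ e' → e * e' = 0

/-- Here `n` is a budget for the rank of `u`: splitting off an eigen-idempotent lowers `‖u‖ ^ 2` by
at least `c`. -/
theorem IsAssocClosed.exists_spectral {A : Submodule ℝ E} (hA : IsAssocClosed A) {c : ℝ}
    (hbound : ∀ p : E, p * p = p → p ≠ 0 → c ≤ ‖p‖ ^ 2) (n : ℕ) :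
    ∀ x ∈ A, ∀ u ∈ A, u * u = u → x * u = x → ‖u‖ ^ 2 ≤ n * c →
      ∃ (s : Finset E) (l : E → ℝ), IsOrthogonalSystem s ∧ (∀ e ∈ s, e * u = e ∧ e ∈ A) ∧
        x = ∑ e ∈ s, l e • e := by
  classical
  induction n with
  | zero =>
    intro x _ u _ _ hxu hn
    have hu0 : u = 0 := by
      have : ‖u‖ ^ 2 = 0 := le_antisymm (by simpa using hn) (sq_nonneg _)
      simpa using this
    refine ⟨∅, 0, ⟨by simp, by simp, by simp⟩, by simp, ?_⟩
    rw [← hxu, hu0]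
    simp
  | succ n ih =>
    intro x hx u hu huu hxu hn
    by_cases hx0 : x = 0
    · exact ⟨∅, 0, ⟨by simp, by simp, by simp⟩, by simp, by simp [hx0]⟩
    obtain ⟨μ, p, hpA, hp0, hp, hpu, hxp⟩ := hA.exists_eigen hx hu hxu hx0
    have hu' := idempotent_sub huu hp hpu
    have hpup : p * (u - p) = 0 := by rw [mul_sub, hpu, hp, sub_self]
    obtain ⟨s, l, hs, hsu, hsum⟩ := ih (x - μ • p) (A.sub_mem hx (A.smul_mem _ hpA)) (u - p)
      (A.sub_mem hu hpA) hu' (by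
        rw [sub_mul, mul_sub, hxu, hxp, smul_mul_assoc, hpup, smul_zero, sub_zero]) (by
        rw [norm_sq_idempotent_sub huu hp hpu]
        push_cast at hn
        linarith [hbound p hp hp0])
    have hep : ∀ e ∈ s, p * e = 0 := fun e he => by
      obtain ⟨h1, h2⟩ := hsu e he
      rw [← h1, mul_comm e, ← hA.assoc _ hpA _ (A.sub_mem hu hpA) _ h2, hpup, zero_mul]
    have hps : p ∉ s := fun h => hp0 (by rw [← hp, hep p h])
    refine ⟨insert p s, fun e => if e = p then μ else l e, ⟨?_, ?_, ?_⟩, ?_, ?_⟩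
    · intro e he
      rcases Finset.mem_insert.1 he with rfl | he
      exacts [hp, hs.idem e he]
    · intro e he
      rcases Finset.mem_insert.1 he with rfl | he
      exacts [hp0, hs.ne_zero e he]
    · intro e he e' he' hne
      rcases Finset.mem_insert.1 he with h | h <;> rcases Finset.mem_insert.1 he' with h' | h'
      · exact absurd (h.trans h'.symm) hne
      · rw [h]; exact hep e' h'
      · rw [h', mul_comm]; exact hep e h
      · exact hs.orth e h e' h' hne
    · intro e he
      rcases Finset.mem_insert.1 he with rfl | he
      · exact ⟨hpu, hpA⟩
      · obtain ⟨h1, h2⟩ := hsu e he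
        refine ⟨?_, h2⟩
        rwa [mul_sub, mul_comm e p, hep e he, sub_zero] at h1
    · rw [Finset.sum_insert hps]
      simp only [if_true]
      rw [← sub_eq_iff_eq_add', hsum]
      refine Finset.sum_congr rfl fun e he => ?_
      rw [if_neg (fun h : e = p => hps (h ▸ he))]

/-- The spectral theorem: every element is a finite linear combination of orthogonal
idempotents. -/
theorem exists_spectral (x : E) :
    ∃ (s : Finset E) (l : E → ℝ), IsOrthogonalSystem s ∧ x = ∑ e ∈ s, l e • e := by
  obtain ⟨c, hc, hbound⟩ := exists_idempotent_norm_bound E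
  obtain ⟨A, hA, hx⟩ := exists_isAssocClosed x
  obtain ⟨n, hn⟩ := exists_nat_ge (‖(1 : E)‖ ^ 2 / c)
  obtain ⟨s, l, hs, -, hsum⟩ := hA.exists_spectral hbound n x hx 1 hA.one_mem (mul_one 1)
    (mul_one x) ((div_le_iff₀ hc).1 hn)
  exact ⟨s, l, hs, hsum⟩

namespace IsOrthogonalSystem

variable {s : Finset E}

theorem sum_mul (hs : IsOrthogonalSystem s) (l : E → ℝ) {e : E} (he : e ∈ s) : (∑ e' ∈ s, l e' • e') * e = l e • e := by
  rw [Finset.sum_mul, Finset.sum_eq_single e]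
  · rw [smul_mul_assoc, hs.idem e he]
  · intro e' he' hne
    rw [smul_mul_assoc, hs.orth e' he' e he hne, smul_zero]
  · exact fun h => absurd he h

theorem mul_sum_id (hs : IsOrthogonalSystem s) {e : E} (he : e ∈ s) : e * (∑ e' ∈ s, e') = e := by
  have := hs.sum_mul (fun _ => 1) he
  simp only [one_smul] at this
  rw [mul_comm, this]

theorem sum_idempotent (hs : IsOrthogonalSystem s) : (∑ e ∈ s, e) * (∑ e ∈ s, e) = ∑ e ∈ s, e := by
  conv_lhs => rw [Finset.sum_mul]
  exact Finset.sum_congr rfl fun e he => hs.mul_sum_id he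

theorem inner_sum (hs : IsOrthogonalSystem s) (l : E → ℝ) {e : E} (he : e ∈ s) :
    inner ℝ (∑ e' ∈ s, l e' • e') e = l e * ‖e‖ ^ 2 := by
  conv_lhs => rw [← hs.idem e he, ← inner_mul_right_comm, hs.sum_mul l he, inner_smul_left]
  rw [real_inner_self_eq_norm_sq]
  rfl

theorem isPos_sum (hs : IsOrthogonalSystem s) {l : E → ℝ} (hl : ∀ e ∈ s, 0 ≤ l e) : IsPos (∑ e ∈ s, l e • e) := by
  refine ⟨∑ e ∈ s, √(l e) • e, ?_⟩
  rw [Finset.mul_sum]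
  refine Finset.sum_congr rfl fun e he => ?_
  rw [mul_smul_comm, hs.sum_mul _ he, smul_smul, Real.mul_self_sqrt (hl e he)]

theorem coeff_nonneg (hs : IsOrthogonalSystem s) {l : E → ℝ} {e : E} (he : e ∈ s)
    (h : 0 ≤ inner ℝ (∑ e' ∈ s, l e' • e') e) : 0 ≤ l e := by
  rw [hs.inner_sum l he] at h
  have : 0 < ‖e‖ ^ 2 := pow_pos (norm_pos_iff.2 (hs.ne_zero e he)) 2
  exact nonneg_of_mul_nonneg_left h this

end IsOrthogonalSystem

/-- This linear description shows that sums of squares are squares. -/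
theorem isPos_iff_inner {x : E} : IsPos x ↔ ∀ p : E, p * p = p → 0 ≤ inner ℝ x p := by
  refine ⟨fun h p hp => h.inner_nonneg hp, fun h => ?_⟩
  obtain ⟨s, l, hs, rfl⟩ := exists_spectral x
  exact hs.isPos_sum fun e he => hs.coeff_nonneg he (h e (hs.idem e he))

theorem IsPos.add {a b : E} (ha : IsPos a) (hb : IsPos b) : IsPos (a + b) :=
  isPos_iff_inner.2 fun p hp => by
    rw [inner_add_left]
    exact add_nonneg (ha.inner_nonneg hp) (hb.inner_nonneg hp)

/-- A positive element is a combination of orthogonal idempotents with positive coefficients. -/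
theorem IsPos.exists_spectral {x : E} (hx : IsPos x) :
    ∃ (s : Finset E) (l : E → ℝ), IsOrthogonalSystem s ∧ (∀ e ∈ s, 0 < l e) ∧
      x = ∑ e ∈ s, l e • e := by
  classical
  obtain ⟨s, l, hs, rfl⟩ := EuclideanJordanAlgebra.exists_spectral x
  have hl : ∀ e ∈ s, 0 ≤ l e := fun e he =>
    hs.coeff_nonneg he (hx.inner_nonneg (hs.idem e he))
  refine ⟨s.filter fun e => l e ≠ 0, l, ⟨?_, ?_, ?_⟩, ?_, ?_⟩
  · exact fun e he => hs.idem e (Finset.mem_of_mem_filter e he)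
  · exact fun e he => hs.ne_zero e (Finset.mem_of_mem_filter e he)
  · exact fun e he e' he' =>
      hs.orth e (Finset.mem_of_mem_filter e he) e' (Finset.mem_of_mem_filter e' he')
  · intro e he
    obtain ⟨h1, h2⟩ := Finset.mem_filter.1 he
    exact lt_of_le_of_ne (hl e h1) h2.symm
  · symm
    refine Finset.sum_filter_of_ne fun e _ h h0 => h ?_
    rw [h0, zero_smul]

/-- A combination, with positive coefficients, of orthogonal idempotents that is orthogonal to an
idempotent `w` has each of its idempotents annihilated by `w`. -/
theorem IsOrthogonalSystem.mul_eq_zero {s : Finset E} (hs : IsOrthogonalSystem s) {l : E → ℝ}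
    (hl : ∀ e ∈ s, 0 < l e) {w : E} (hw : w * w = w)
    (h : inner ℝ (∑ e ∈ s, l e • e) w = 0) : ∀ e ∈ s, w * e = 0 := by
  intro e he
  rw [sum_inner] at h
  simp only [inner_smul_left] at h
  have h0 := (Finset.sum_eq_zero_iff_of_nonneg fun e he => mul_nonneg (hl e he).le
    ((isPos_of_idempotent (hs.idem e he)).inner_nonneg hw)).1 h e he
  refine mul_eq_zero_of_idempotents (hs.idem e he) hw ?_
  exact (_root_.mul_eq_zero.1 h0).resolve_left (hl e he).ne'

end Spectral

/-! ### Kernel idempotents and the image -/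

section Image

variable {E F : Type*} [EuclideanJordanAlgebra E] [EuclideanJordanAlgebra F]

theorem IsPosMap.map_eq_zero {f : E →ₗ[ℝ] F} (hf : IsPosMap f) {s : Finset E}
    (hs : IsOrthogonalSystem s) {l : E → ℝ} (hl : ∀ e ∈ s, 0 < l e)
    (h : f (∑ e ∈ s, l e • e) = 0) : ∀ e ∈ s, f e = 0 := by
  intro e he
  have hpos : ∀ e ∈ s, IsPos (f e) := fun e he => hf e (isPos_of_idempotent (hs.idem e he))
  have h1 := congrArg (fun z => inner ℝ z (1 : F)) h
  simp only [map_sum, map_smul, sum_inner, inner_smul_left, inner_zero_left] at h1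
  have h0 := (Finset.sum_eq_zero_iff_of_nonneg fun e he => mul_nonneg (hl e he).le
    (hpos e he).inner_one_nonneg).1 h1 e he
  exact (hpos e he).eq_zero_of_inner_one ((_root_.mul_eq_zero.1 h0).resolve_left (hl e he).ne')

/-- The kernel of a positive map contains an idempotent that dominates the kernel's effects. -/
theorem IsPosMap.exists_max_idempotent {f : E →ₗ[ℝ] F} (hf : IsPosMap f) :
    ∃ p : E, p * p = p ∧ f p = 0 ∧
      ∀ r : E, IsPos r → f r = 0 → inner ℝ r (1 - p) = 0 := by
  obtain ⟨c, hc, hbound⟩ := exists_idempotent_norm_bound E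
  let S : Set ℝ := {t | ∃ p : E, p * p = p ∧ f p = 0 ∧ t = ‖p‖ ^ 2}
  have hS : BddAbove S := ⟨‖(1 : E)‖ ^ 2, by
    rintro _ ⟨p, hp, -, rfl⟩; exact norm_sq_le_of_idempotent hp⟩
  have hne : S.Nonempty := ⟨_, 0, by simp, by simp, rfl⟩
  -- Within `c` of the supremum, no strictly larger kernel idempotent fits.
  obtain ⟨_, ⟨p, hp, hfp, rfl⟩, hlt⟩ := exists_lt_of_lt_csSup hne (sub_lt_self (sSup S) hc)
  refine ⟨p, hp, hfp, fun r hr hfr => ?_⟩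
  obtain ⟨s, l, hs, hl, hsum⟩ := ((isPos_of_idempotent hp).add hr).exists_spectral
  have hfs : ∀ e ∈ s, f e = 0 := hf.map_eq_zero hs hl (by rw [← hsum, map_add, hfp, hfr, add_zero])
  set q := ∑ e ∈ s, e with hq
  have hqq : q * q = q := hs.sum_idempotent
  have hfq : f q = 0 := by rw [hq, map_sum]; exact Finset.sum_eq_zero hfs
  have hw := idempotent_one_sub hqq
  -- As `q` supports `p + r`, the two nonnegative terms of this pairing both vanish.
  have hzero : inner ℝ (p + r) (1 - q) = 0 := by
    rw [hsum, sum_inner]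
    refine Finset.sum_eq_zero fun e he => ?_
    rw [inner_smul_left, ← hs.idem e he, inner_mul, mul_sub, hs.mul_sum_id he, mul_one, sub_self,
      inner_zero_right, mul_zero]
  rw [inner_add_left] at hzero
  have hp1 := (isPos_of_idempotent hp).inner_nonneg hw
  have hr1 := hr.inner_nonneg hw
  have hpq : p * q = p := by
    have := mul_eq_zero_of_idempotents hp hw (by linarith)
    rw [sub_mul, one_mul, sub_eq_zero, mul_comm] at this
    exact this.symm
  have hqp : q = p := by
    by_contra hne
    have h1 := hbound (q - p) (idempotent_sub hqq hp hpq) (sub_ne_zero.2 hne)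
    rw [norm_sq_idempotent_sub hqq hp hpq] at h1
    have h2 : ‖q‖ ^ 2 ≤ sSup S := le_csSup hS ⟨q, hqq, hfq, rfl⟩
    linarith
  rw [← hqp]
  linarith

theorem le_of_inner_eq_zero {p r : E} (hp : p * p = p) (hr : IsEffect r)
    (h : inner ℝ r (1 - p) = 0) : Le r p := by
  have hpos : IsPos r := by simpa [Le] using hr.1
  obtain ⟨s, l, hs, hl, rfl⟩ := hpos.exists_spectral
  have hep : ∀ e ∈ s, e * p = e := fun e he => by
    have := hs.mul_eq_zero hl (idempotent_one_sub hp) h e he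
    rw [sub_mul, one_mul, sub_eq_zero, mul_comm] at this
    exact this.symm
  have hl1 : ∀ e ∈ s, 0 ≤ 1 - l e := fun e he => by
    have h1 := IsPos.inner_nonneg hr.2 (hs.idem e he)
    rw [inner_sub_left, hs.inner_sum l he, real_inner_comm,
      ← norm_sq_of_idempotent (hs.idem e he)] at h1
    have : 0 < ‖e‖ ^ 2 := pow_pos (norm_pos_iff.2 (hs.ne_zero e he)) 2
    nlinarith
  have hqp : (∑ e ∈ s, e) * p = ∑ e ∈ s, e := by
    rw [Finset.sum_mul]
    exact Finset.sum_congr rfl hep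
  -- With `q = ∑ e`, write `p - r = (p - q) + ∑ (1 - l e) • e`.
  have key := (isPos_of_idempotent (idempotent_sub hp hs.sum_idempotent hqp)).add (hs.isPos_sum hl1)
  simp only [sub_smul, one_smul, Finset.sum_sub_distrib] at key
  simpa [Le] using key

theorem IsPosMap.exists_idempotent_image {f : E →ₗ[ℝ] F} (hf : IsPosMap f) :
    ∃ q : E, q * q = q ∧ IsImage f q := by
  obtain ⟨p, hp, hfp, hmax⟩ := hf.exists_max_idempotent
  have hq := idempotent_one_sub hp
  refine ⟨1 - p, hq, ⟨isEffect_of_idempotent hq, by rw [map_sub, hfp, sub_zero]⟩, fun r hr hfr => ?_⟩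
  have hr' := isEffect_one_sub hr
  have h := le_of_inner_eq_zero hp hr'
    (hmax (1 - r) (by simpa [Le] using hr'.1) (by rw [map_sub, hfr, sub_self]))
  unfold Le at h ⊢
  convert h using 1
  abel

theorem IsImage.unique {f : E →ₗ[ℝ] F} {q q' : E} (h : IsImage f q) (h' : IsImage f q') :
    q = q' :=
  (h.2 q' h'.1.1 h'.1.2).antisymm (h'.2 q h.1.1 h.1.2)

end Image

end EuclideanJordanAlgebra

theorem mainTheorem7 {E F : Type*} [EuclideanJordanAlgebra E] [EuclideanJordanAlgebra F]
    (f : E →ₗ[ℝ] F) (hf : EuclideanJordanAlgebra.IsPosMap f) :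
    (∃! q : E, EuclideanJordanAlgebra.IsImage f q) ∧
      ∀ q : E, EuclideanJordanAlgebra.IsImage f q → IsIdempotentElem q := by
  obtain ⟨q, hq, himg⟩ := hf.exists_idempotent_image
  exact ⟨⟨q, himg, fun q' h => h.unique himg⟩, fun q' h => h.unique himg ▸ hq⟩
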